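/- Let $M\subseteq\mathbb R$ be an interval (open, closed, half-open, bounded or not), with the distance $d(x,y)=|x-y|$ and its Lebesgue measure $\lambda$. For positive measures $\mu,\nu$ on $M$, let $\Gamma(\mu,\nu)$ be the set of positive measures on $M\times M$ with first marginal $\mu$ and second marginal $\nu$, and put $$W_2(\mu,\nu)=\Big(\inf_{\pi\in\Gamma(\mu,\nu)}\int_{M\times M}|x-y|^2\,\pi(dx\,dy)\Big)^{1/2}\in[0,\infty],\qquad \inf\emptyset=\infty .$$ For a signed measure $\sigma$ of finite total variation on $M$, put $$\|\sigma\|_{\dot H^{-1}}=\sup\Big\{\Big|\int_M f\,d\sigma\Big| \;:\; f\in C^1(M)\text{ bounded},\ \int_M |f'|^2\,d\lambda\le 1\Big\}\in[0,\infty].$$ Let $\rho_0>0$ and let $\mu$ be a positive measure on $M$ with $\mu\le\rho_0\lambda$. Then for every positive measure $\nu$ on $M$ such that $\nu-\mu$ is a signed measure of finite total variation (in particular, whenever $\mu$ and $\nu$ are finite), $$\|\nu-\mu\|_{\dot H^{-1}}\le 2\,\rho_0^{1/2}\,W_2(\mu,\nu).$$ No upper density bound is assumed for $\nu$. Here, if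 $\mu,\nu$ are infinite, "$\nu-\mu$ is the signed measure $\sigma$" means $\nu+\sigma^-=\mu+\sigma^+$, where $\sigma=\sigma^+-\sigma^-$ is the Jordan decomposition. -/

import Mathlib

open MeasureTheory
open scoped ENNReal NNReal

noncomputable section

namespace HSobolevWasserstein

/-- `π` has marginals `μ` and `ν`, that is, `π ∈ Γ(μ, ν)`. -/
def IsCoupling {X : Type*} [MeasurableSpace X] (μ ν : Measure X) (π : Measure (X × X)) : Prop :=
  π.map Prod.fst = μ ∧ π.map Prod.snd = ν

/-- The transport cost `I[π] = ∫ d(x,y)² π(dx dy)`. -/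
def transportCost {X : Type*} [PseudoEMetricSpace X] [MeasurableSpace X]
    (π : Measure (X × X)) : ℝ≥0∞ :=
  ∫⁻ p, edist p.1 p.2 ^ 2 ∂π

/-- The quadratic Wasserstein distance `W₂(μ, ν)`; it is `∞` if there is no coupling. -/
def W2 {X : Type*} [PseudoEMetricSpace X] [MeasurableSpace X] (μ ν : Measure X) : ℝ≥0∞ :=
  (⨅ (π : Measure (X × X)) (_ : IsCoupling μ ν π), transportCost π) ^ (1 / 2 : ℝ)

/-- The signed measure `σ` (of finite total variation) is the difference `ν - μ` of two positive,
possibly infinite, measures: `ν + σ⁻ = μ + σ⁺`, with `σ = σ⁺ - σ⁻` the Jordan decomposition. -/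
def IsDifference {X : Type*} [MeasurableSpace X] (σ : SignedMeasure X) (ν μ : Measure X) : Prop :=
  ν + σ.toJordanDecomposition.negPart = μ + σ.toJordanDecomposition.posPart

/-- The pairing `⟨f, σ⟩ = ∫ f dσ` of a function with a signed measure. -/
def pairing {X : Type*} [MeasurableSpace X] (f : X → ℝ) (σ : SignedMeasure X) : ℝ :=
  ∫ x, f x ∂σ.toJordanDecomposition.posPart - ∫ x, f x ∂σ.toJordanDecomposition.negPart

/-- Bounded `C¹` real functions on `M ⊆ ℝ` (with one-sided derivatives at the endpoints of `M`
that belong to `M`). Only the values of `f` on `M` matter. -/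
def IsBoundedC1 (M : Set ℝ) (f : ℝ → ℝ) : Prop :=
  ContDiffOn ℝ 1 f M ∧ ∃ C : ℝ, ∀ x ∈ M, |f x| ≤ C

/-- The Lebesgue measure `λ` on `M ⊆ ℝ`, as a measure on the subtype: `λ(A) = volume(A)` for
measurable `A ⊆ M`. -/
def lebesgueOn (M : Set ℝ) : Measure M :=
  (volume : Measure ℝ).comap ((↑) : M → ℝ)

/-- The seminorm `‖f‖_{Ḣ¹} = (∫_M |f'|² dλ)^{1/2}`, `λ` the Lebesgue measure on `M`. -/
def H1seminorm (M : Set ℝ) (f : ℝ → ℝ) : ℝ≥0∞ :=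
  (∫⁻ x : M, ‖derivWithin f M x‖ₑ ^ 2 ∂lebesgueOn M) ^ (1 / 2 : ℝ)

/-- The norm `‖σ‖_{Ḣ⁻¹} = sup { |⟨f, σ⟩| : f bounded C¹ on M, ‖f‖_{Ḣ¹} ≤ 1 }`. -/
def Hm1norm (M : Set ℝ) (σ : SignedMeasure M) : ℝ≥0∞ :=
  ⨆ (f : ℝ → ℝ) (_ : IsBoundedC1 M f) (_ : H1seminorm M f ≤ 1),
    ENNReal.ofReal |pairing (fun x : M => f x) σ|

end HSobolevWasserstein

end

namespace HSobolevWasserstein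

open Filter Topology

/-! For a plan `π`, the pairing of `σ` with `f` is the integral of `f y - f x` over `π`, so it
suffices to bound the integral of `|f y - f x|`. The upward moves contribute at most `∫ m |f'|`,
where `m t` is the mass carried upwards across `t` (`upFlux`), and Cauchy–Schwarz leaves the L² norm
of `m` to estimate.

Expanding the square, `∫ m²` is the `π ⊗ π`-average of the overlap of two transport intervals. The
overlap is controlled by the interval that starts first and the starting point of the other;
starting points have density at most `ρ₀`, whence `∫ m² ≤ ρ₀ I[π]` (`lintegral_upFlux_sq_le`).
Targets are never integrated alone, so `ν` needs no density bound. Downward moves follow by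
reflection, which gives the factor 2.

The measures may be infinite, so `f` is first multiplied by a cutoff at scale `R`. As `f` is
bounded, the extra error is of order `R^(-1/2)` and vanishes in the limit
(`enorm_pairing_le_of_coupling`). -/

/-! ### Overlaps of transport intervals and the L² bound on the flux -/

lemma lintegral_Ici_ofReal_sub (a b : ℝ) :
    ∫⁻ x in Set.Ici a, ENNReal.ofReal (b - x) = ENNReal.ofReal (b - a) ^ 2 / 2 := by
  rcases le_total b a with hab | hab
  · rw [ENNReal.ofReal_of_nonpos (by linarith), setLIntegral_congr_fun measurableSet_Ici
      (g := fun _ => 0) fun x hx => ENNReal.ofReal_of_nonpos (by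
        have : a ≤ x := hx
        linarith)]
    simp
  · have h1 : ∫⁻ x in Set.Ici a, ENNReal.ofReal (b - x)
        = ∫⁻ x in Set.Icc a b, ENNReal.ofReal (b - x) := by
      rw [← lintegral_indicator measurableSet_Ici, ← lintegral_indicator measurableSet_Icc]
      congr 1
      ext x
      by_cases hx : a ≤ x <;> by_cases hx' : x ≤ b <;> simp [Set.indicator, hx, hx']
      linarith
    rw [h1, ← ofReal_integral_eq_lintegral_ofReal, integral_Icc_eq_integral_Ioc,
      ← intervalIntegral.integral_of_le hab]
    · have : ∫ x in a..b, (b - x) = (b - a) ^ 2 / 2 := by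
        rw [intervalIntegral.integral_sub (by simp) (by simp)]
        simp
        ring
      rw [this, ENNReal.ofReal_div_of_pos (by norm_num), ENNReal.ofReal_pow (by linarith)]
      simp
    · exact (by fun_prop : Continuous fun x : ℝ => b - x).continuousOn.integrableOn_Icc
    · filter_upwards [ae_restrict_mem measurableSet_Icc] with x hx
      simpa using hx.2

/-- The overlap begins at the later left endpoint and ends no later than the right endpoint of the
interval that starts first. The later interval enters only through its left endpoint, so only the
first marginal is needed. -/
lemma volume_Ioc_inter_Ioc_le (a b c d : ℝ) :
    volume (Set.Ioc a b ∩ Set.Ioc c d) ≤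
      (Set.Ici a).indicator (fun s => ENNReal.ofReal (b - s)) c +
        (Set.Ici c).indicator (fun s => ENNReal.ofReal (d - s)) a := by
  rw [Set.Ioc_inter_Ioc, Real.volume_Ioc]
  rcases le_total a c with h | h
  · refine le_add_right ?_
    rw [Set.indicator_of_mem (by exact h)]
    exact ENNReal.ofReal_le_ofReal (sub_le_sub (min_le_left _ _) (le_max_right _ _))
  · refine le_add_left ?_
    rw [Set.indicator_of_mem (by exact h)]
    exact ENNReal.ofReal_le_ofReal (sub_le_sub (min_le_right _ _) (le_max_left _ _))

lemma measurableSet_mem_Ioc_fst_snd :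
    MeasurableSet {q : (ℝ × ℝ) × ℝ | q.2 ∈ Set.Ioc q.1.1 q.1.2} :=
  MeasurableSet.inter (s₁ := {q : (ℝ × ℝ) × ℝ | q.1.1 < q.2}) (s₂ := {q | q.2 ≤ q.1.2})
    (measurableSet_lt (by fun_prop) (by fun_prop)) (measurableSet_le (by fun_prop) (by fun_prop))

lemma measurable_indicator_Ioc (h : ℝ → ℝ≥0∞) (hh : Measurable h) :
    Measurable fun q : (ℝ × ℝ) × ℝ => (Set.Ioc q.1.1 q.1.2).indicator h q.2 := by
  have : (fun q : (ℝ × ℝ) × ℝ => (Set.Ioc q.1.1 q.1.2).indicator h q.2) =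
      {q : (ℝ × ℝ) × ℝ | q.2 ∈ Set.Ioc q.1.1 q.1.2}.indicator fun q => h q.2 := by
    ext q
    simp [Set.indicator]
  rw [this]
  exact (hh.comp measurable_snd).indicator measurableSet_mem_Ioc_fst_snd

/-- The mass that `π` transports upwards across the point `t`. -/
noncomputable def upFlux (π : Measure (ℝ × ℝ)) (t : ℝ) : ℝ≥0∞ :=
  ∫⁻ p, (Set.Ioc p.1 p.2).indicator 1 t ∂π

lemma measurable_upFlux (π : Measure (ℝ × ℝ)) [SFinite π] : Measurable (upFlux π) :=
  (measurable_indicator_Ioc 1 measurable_one).lintegral_prod_left'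

lemma measurable_indicator_Ici_ofReal_sub :
    Measurable fun z : (ℝ × ℝ) × (ℝ × ℝ) =>
      (Set.Ici z.1.1).indicator (fun s => ENNReal.ofReal (z.1.2 - s)) z.2.1 := by
  have : (fun z : (ℝ × ℝ) × (ℝ × ℝ) =>
      (Set.Ici z.1.1).indicator (fun s => ENNReal.ofReal (z.1.2 - s)) z.2.1) =
      {z : (ℝ × ℝ) × (ℝ × ℝ) | z.1.1 ≤ z.2.1}.indicator
        fun z => ENNReal.ofReal (z.1.2 - z.2.1) := by
    ext z
    simp [Set.indicator]
  rw [this]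
  exact Measurable.indicator (by fun_prop) (measurableSet_le (by fun_prop) (by fun_prop))

/-- By Tonelli the left side is the double integral of overlaps. The two halves of the overlap bound
agree under `p ↔ q`; this factor 2 cancels the 1/2 from integrating `p.2 - s` over `s ≥ p.1`. -/
lemma lintegral_upFlux_sq_le (π : Measure (ℝ × ℝ)) [SFinite π] (c : ℝ≥0∞)
    (hπ : π.map Prod.fst ≤ c • volume) :
    ∫⁻ t, upFlux π t ^ 2 ≤ c * ∫⁻ p, ENNReal.ofReal (p.2 - p.1) ^ 2 ∂π := by
  have hind := measurable_indicator_Ioc 1 measurable_one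
  set F : ℝ × ℝ → ℝ × ℝ → ℝ≥0∞ := fun p q =>
    (Set.Ici p.1).indicator (fun s => ENNReal.ofReal (p.2 - s)) q.1 with hF
  have hFm : Measurable fun z : (ℝ × ℝ) × (ℝ × ℝ) => F z.1 z.2 :=
    measurable_indicator_Ici_ofReal_sub
  have hFm' : Measurable fun z : (ℝ × ℝ) × (ℝ × ℝ) => F z.2 z.1 :=
    hFm.comp measurable_swap
  have h1 : ∀ p : ℝ × ℝ, ∫⁻ q, F p q ∂π ≤ c * (ENNReal.ofReal (p.2 - p.1) ^ 2 / 2) := by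
    intro p
    have hm : Measurable ((Set.Ici p.1).indicator fun s => ENNReal.ofReal (p.2 - s)) :=
      Measurable.indicator (by fun_prop) measurableSet_Ici
    calc ∫⁻ q, F p q ∂π
        = ∫⁻ s, (Set.Ici p.1).indicator (fun s => ENNReal.ofReal (p.2 - s)) s
            ∂(π.map Prod.fst) := (lintegral_map hm measurable_fst).symm
      _ ≤ ∫⁻ s, (Set.Ici p.1).indicator (fun s => ENNReal.ofReal (p.2 - s)) s
            ∂(c • volume) := lintegral_mono' hπ le_rfl
      _ = _ := by
        rw [lintegral_smul_measure, lintegral_indicator measurableSet_Ici,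
          lintegral_Ici_ofReal_sub, smul_eq_mul]
  calc ∫⁻ t, upFlux π t ^ 2
      = ∫⁻ t, ∫⁻ p, ∫⁻ q, (Set.Ioc p.1 p.2).indicator 1 t *
          (Set.Ioc q.1 q.2).indicator 1 t ∂π ∂π := by
        refine lintegral_congr fun t => ?_
        have hm : Measurable fun p : ℝ × ℝ => (Set.Ioc p.1 p.2).indicator (1 : ℝ → ℝ≥0∞) t :=
          hind.comp (measurable_id.prodMk measurable_const)
        rw [sq, upFlux, ← lintegral_mul_const _ hm]
        exact lintegral_congr fun p => (lintegral_const_mul _ hm).symm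
    _ = ∫⁻ p, ∫⁻ q, (∫⁻ t, (Set.Ioc p.1 p.2).indicator 1 t *
          (Set.Ioc q.1 q.2).indicator 1 t) ∂π ∂π := by
        have hm1 : Measurable fun z : (ℝ × (ℝ × ℝ)) × (ℝ × ℝ) =>
            (Set.Ioc z.1.2.1 z.1.2.2).indicator (1 : ℝ → ℝ≥0∞) z.1.1 *
              (Set.Ioc z.2.1 z.2.2).indicator 1 z.1.1 :=
          (hind.comp (f := fun z : (ℝ × (ℝ × ℝ)) × (ℝ × ℝ) => (z.1.2, z.1.1))
            (by fun_prop)).mul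
          (hind.comp (f := fun z : (ℝ × (ℝ × ℝ)) × (ℝ × ℝ) => (z.2, z.1.1)) (by fun_prop))
        rw [lintegral_lintegral_swap hm1.lintegral_prod_right'.aemeasurable]
        refine lintegral_congr fun p => ?_
        rw [lintegral_lintegral_swap]
        exact (hm1.comp (f := fun z : ℝ × (ℝ × ℝ) => ((z.1, p), z.2))
          (by fun_prop)).aemeasurable
    _ = ∫⁻ p, ∫⁻ q, volume (Set.Ioc p.1 p.2 ∩ Set.Ioc q.1 q.2) ∂π ∂π := by
        refine lintegral_congr fun p => lintegral_congr fun q => ?_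
        rw [← lintegral_indicator_one (measurableSet_Ioc.inter measurableSet_Ioc)]
        refine lintegral_congr fun t => ?_
        rw [Set.inter_indicator_one]
        rfl
    _ ≤ ∫⁻ p, ∫⁻ q, (F p q + F q p) ∂π ∂π :=
        lintegral_mono fun p => lintegral_mono fun q => volume_Ioc_inter_Ioc_le _ _ _ _
    _ = (∫⁻ p, ∫⁻ q, F p q ∂π ∂π) + ∫⁻ p, ∫⁻ q, F q p ∂π ∂π := by
        rw [← lintegral_add_left hFm.lintegral_prod_right']
        exact lintegral_congr fun p =>
          lintegral_add_left (hFm.comp (measurable_const.prodMk measurable_id)) _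
    _ = 2 * ∫⁻ p, ∫⁻ q, F p q ∂π ∂π := by
        rw [lintegral_lintegral_swap (f := fun p q => F q p) hFm'.aemeasurable, two_mul]
    _ ≤ 2 * ∫⁻ p, c * (ENNReal.ofReal (p.2 - p.1) ^ 2 / 2) ∂π := by
        gcongr with p
        exact h1 p
    _ = c * ∫⁻ p, ENNReal.ofReal (p.2 - p.1) ^ 2 ∂π := by
        rw [← lintegral_const_mul _ (by fun_prop), ← lintegral_const_mul _ (by fun_prop)]
        refine lintegral_congr fun p => ?_
        rw [mul_left_comm, ENNReal.mul_div_cancel (by simp) (by simp)]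

/-! ### Increments along a transport plan -/

lemma lintegral_setLIntegral_Ioc_le (π : Measure (ℝ × ℝ)) [SFinite π] (c : ℝ≥0∞)
    (hπ : π.map Prod.fst ≤ c • volume) (h : ℝ → ℝ≥0∞) (hh : Measurable h) :
    ∫⁻ p, (∫⁻ t in Set.Ioc p.1 p.2, h t) ∂π ≤
      (c * transportCost π) ^ (1 / 2 : ℝ) * (∫⁻ t, h t ^ 2) ^ (1 / 2 : ℝ) := by
  have hcost : ∫⁻ p, ENNReal.ofReal (p.2 - p.1) ^ 2 ∂π ≤ transportCost π := by
    refine lintegral_mono fun p => ?_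
    dsimp only
    rw [edist_comm, edist_dist, Real.dist_eq]
    gcongr
    exact le_abs_self _
  calc ∫⁻ p, (∫⁻ t in Set.Ioc p.1 p.2, h t) ∂π
      = ∫⁻ p, (∫⁻ t, (Set.Ioc p.1 p.2).indicator h t) ∂π := by
        simp_rw [lintegral_indicator measurableSet_Ioc]
    _ = ∫⁻ t, ∫⁻ p, (Set.Ioc p.1 p.2).indicator h t ∂π :=
        lintegral_lintegral_swap (measurable_indicator_Ioc h hh).aemeasurable
    _ = ∫⁻ t, (upFlux π * h) t := by
        refine lintegral_congr fun t => ?_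
        have hm : Measurable fun p : ℝ × ℝ => (Set.Ioc p.1 p.2).indicator (1 : ℝ → ℝ≥0∞) t :=
          (measurable_indicator_Ioc 1 measurable_one).comp
            (measurable_id.prodMk measurable_const)
        rw [Pi.mul_apply, upFlux, ← lintegral_mul_const _ hm]
        refine lintegral_congr fun p => ?_
        by_cases ht : t ∈ Set.Ioc p.1 p.2 <;> simp [ht, -Set.mem_Ioc]
    _ ≤ (∫⁻ t, upFlux π t ^ (2 : ℝ)) ^ (1 / 2 : ℝ) * (∫⁻ t, h t ^ (2 : ℝ)) ^ (1 / 2 : ℝ) :=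
        ENNReal.lintegral_mul_le_Lp_mul_Lq _ Real.HolderConjugate.two_two
          (measurable_upFlux π).aemeasurable hh.aemeasurable
    _ ≤ _ := by
        simp_rw [ENNReal.rpow_two]
        gcongr
        exact (lintegral_upFlux_sq_le π c hπ).trans (by gcongr)

/-- Reflection through the origin turns downward moves into upward ones and preserves Lebesgue
measure and the cost. It exchanges `Ioc` and `Ico`. -/
lemma lintegral_setLIntegral_Ico_le (π : Measure (ℝ × ℝ)) [SFinite π] (c : ℝ≥0∞)
    (hπ : π.map Prod.fst ≤ c • volume) (h : ℝ → ℝ≥0∞) (hh : Measurable h) :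
    ∫⁻ p, (∫⁻ t in Set.Ico p.2 p.1, h t) ∂π ≤
      (c * transportCost π) ^ (1 / 2 : ℝ) * (∫⁻ t, h t ^ 2) ^ (1 / 2 : ℝ) := by
  have hmp : Measure.map (fun x : ℝ => -x) volume = volume :=
    (Measure.measurePreserving_neg (volume : Measure ℝ)).map_eq
  have hneg : Measurable fun p : ℝ × ℝ => -p := by fun_prop
  have hrefl : (π.map fun p => -p).map Prod.fst ≤ c • volume := by
    rw [Measure.map_map measurable_fst hneg,
      show (Prod.fst ∘ fun p : ℝ × ℝ => -p) = (fun x : ℝ => -x) ∘ Prod.fst from rfl,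
      ← Measure.map_map measurable_neg measurable_fst]
    refine (Measure.map_mono hπ measurable_neg).trans ?_
    rw [Measure.map_smul, hmp]
  have key := lintegral_setLIntegral_Ioc_le (π.map fun p => -p) c hrefl (fun t => h (-t))
    (hh.comp measurable_neg)
  have hcost : transportCost (π.map fun p => -p) = transportCost π := by
    rw [transportCost, lintegral_map (by fun_prop) hneg]
    simp [transportCost]
  have hsq : ∫⁻ t, h (-t) ^ 2 = ∫⁻ t, h t ^ 2 := by
    conv_rhs => rw [← hmp]
    rw [lintegral_map (by fun_prop) measurable_neg]
  rw [hcost, hsq, lintegral_map _ hneg] at key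
  · refine le_of_eq_of_le (lintegral_congr fun p => ?_) key
    rw [← lintegral_indicator measurableSet_Ioc, ← lintegral_indicator measurableSet_Ico]
    conv_lhs => rw [← hmp]
    rw [lintegral_map (hh.indicator measurableSet_Ico) measurable_neg]
    refine lintegral_congr fun t => ?_
    have : -t ∈ Set.Ico p.2 p.1 ↔ t ∈ Set.Ioc (-p).1 (-p).2 := by
      simp only [Set.mem_Ico, Set.mem_Ioc, Prod.fst_neg, Prod.snd_neg]
      constructor <;> rintro ⟨h1, h2⟩ <;> constructor <;> linarith
    simp only [Set.indicator, this]
  · simp_rw [← lintegral_indicator measurableSet_Ioc]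
    exact (measurable_indicator_Ioc _ (hh.comp measurable_neg)).lintegral_prod_right'

/-- If the increments of `F` on `M` are bounded by the integrals of `h`, the total variation of `F`
along a transport plan whose first marginal has density at most `c` is controlled by the cost of the
plan and the `L²` norm of `h`. -/
lemma lintegral_enorm_sub_le {M : Set ℝ} (π : Measure (ℝ × ℝ)) [SFinite π] (c : ℝ≥0∞)
    (hπ : π.map Prod.fst ≤ c • volume) (hM : ∀ᵐ p ∂π, p.1 ∈ M ∧ p.2 ∈ M)
    (F : ℝ → ℝ) (h : ℝ → ℝ≥0∞) (hh : Measurable h)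
    (hF : ∀ x ∈ M, ∀ y ∈ M, x ≤ y → ‖F y - F x‖ₑ ≤ ∫⁻ t in Set.Ioc x y, h t) :
    ∫⁻ p, ‖F p.2 - F p.1‖ₑ ∂π ≤
      2 * ((c * transportCost π) ^ (1 / 2 : ℝ) * (∫⁻ t, h t ^ 2) ^ (1 / 2 : ℝ)) := by
  have hm : Measurable fun p : ℝ × ℝ => ∫⁻ t in Set.Ioc p.1 p.2, h t := by
    simp_rw [← lintegral_indicator measurableSet_Ioc]
    exact (measurable_indicator_Ioc _ hh).lintegral_prod_right'
  calc ∫⁻ p, ‖F p.2 - F p.1‖ₑ ∂π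
      ≤ ∫⁻ p, ((∫⁻ t in Set.Ioc p.1 p.2, h t) + ∫⁻ t in Set.Ico p.2 p.1, h t) ∂π := by
        refine lintegral_mono_ae ?_
        filter_upwards [hM] with p hp
        rcases le_total p.1 p.2 with hle | hle
        · exact le_add_right (hF _ hp.1 _ hp.2 hle)
        · refine le_add_left ?_
          rw [← enorm_neg, neg_sub, setLIntegral_congr Ico_ae_eq_Ioc]
          exact hF _ hp.2 _ hp.1 hle
    _ ≤ _ := by
        rw [lintegral_add_left hm, two_mul]
        exact add_le_add (lintegral_setLIntegral_Ioc_le π c hπ h hh)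
          (lintegral_setLIntegral_Ico_le π c hπ h hh)

/-! ### C¹ functions on an interval -/

lemma continuousOn_derivWithin_of_ordConnected {M : Set ℝ} (hM : M.OrdConnected) {f : ℝ → ℝ}
    (hf : ContDiffOn ℝ 1 f M) : ContinuousOn (derivWithin f M) M := by
  rcases M.subsingleton_or_nontrivial with hs | hs
  · exact hs.continuousOn _
  · exact hf.continuousOn_derivWithin
      ((convex_iff_ordConnected.2 hM).nontrivial_iff_nonempty_interior.1 hs |>
        uniqueDiffOn_convex (convex_iff_ordConnected.2 hM)) le_rfl

lemma measurable_indicator_of_continuousOn {β : Type*} [TopologicalSpace β] [MeasurableSpace β]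
    [BorelSpace β] [Zero β] {M : Set ℝ} (hM : MeasurableSet M) {g : ℝ → β}
    (hg : ContinuousOn g M) : Measurable (M.indicator g) := by
  classical
  have := hg.measurable_piecewise (g := 0) continuousOn_const hM
  rwa [Set.piecewise_eq_indicator] at this

lemma enorm_sub_le_setLIntegral_derivWithin {M : Set ℝ} (hM : M.OrdConnected) {f : ℝ → ℝ}
    (hf : ContDiffOn ℝ 1 f M) {x y : ℝ} (hx : x ∈ M) (hy : y ∈ M) (hxy : x ≤ y) :
    ‖f y - f x‖ₑ ≤ ∫⁻ t in Set.Ioc x y, M.indicator (fun t => ‖derivWithin f M t‖ₑ) t := by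
  have hsub : Set.Icc x y ⊆ M := hM.out hx hy
  have hd := (continuousOn_derivWithin_of_ordConnected hM hf).mono hsub
  have hftc : ∫ t in x..y, derivWithin f M t = f y - f x := by
    refine intervalIntegral.integral_eq_sub_of_hasDeriv_right_of_le hxy
      (hf.continuousOn.mono hsub) (fun t ht => ?_) ?_
    · have hn : M ∈ 𝓝 t := mem_of_superset (Icc_mem_nhds ht.1 ht.2) hsub
      have := ((hf.differentiableOn one_ne_zero) t (mem_of_mem_nhds hn)).hasDerivWithinAt
      exact (this.hasDerivAt hn).hasDerivWithinAt
    · exact hd.intervalIntegrable_of_Icc hxy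
  rw [← hftc, intervalIntegral.integral_of_le hxy]
  refine (enorm_integral_le_lintegral_enorm _).trans (le_of_eq ?_)
  refine setLIntegral_congr_fun measurableSet_Ioc fun t ht => ?_
  simp only [Set.indicator_of_mem (hsub (Set.Ioc_subset_Icc_self ht))]

lemma lintegral_indicator_derivWithin_sq {M : Set ℝ} (hM : M.OrdConnected) (f : ℝ → ℝ) :
    (∫⁻ t, M.indicator (fun t => ‖derivWithin f M t‖ₑ) t ^ 2) ^ (1 / 2 : ℝ) =
      H1seminorm M f := by
  rw [H1seminorm, lebesgueOn,
    lintegral_subtype_comap hM.measurableSet (fun x => ‖derivWithin f M x‖ₑ ^ 2),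
    ← lintegral_indicator hM.measurableSet]
  congr 2
  ext t
  by_cases ht : t ∈ M <;> simp [ht]

/-! ### Cutoffs of small Ḣ¹ seminorm -/

/-- The cutoff function equal to `1` on `[-R, R]`, to `0` outside `[-2R, 2R]`, and affine between. -/
noncomputable def cutoff (R x : ℝ) : ℝ := max 0 (min 1 (2 - |x| / R))

lemma cutoff_nonneg (R x : ℝ) : 0 ≤ cutoff R x := le_max_left _ _

lemma cutoff_le_one (R x : ℝ) : cutoff R x ≤ 1 := max_le zero_le_one (min_le_left _ _)

lemma continuous_cutoff (R : ℝ) : Continuous (cutoff R) := by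
  unfold cutoff
  fun_prop

lemma cutoff_eq_zero {R x : ℝ} (hR : 0 < R) (hx : 2 * R ≤ |x|) : cutoff R x = 0 := by
  refine max_eq_left ((min_le_right _ _).trans ?_)
  rw [sub_nonpos, le_div_iff₀ hR]
  exact hx

lemma cutoff_eq_one {R x : ℝ} (hR : 0 < R) (hx : |x| ≤ R) : cutoff R x = 1 := by
  have : 1 ≤ 2 - |x| / R := by
    have := (div_le_one hR).2 hx
    linarith
  rw [cutoff, min_eq_left this, max_eq_right zero_le_one]

lemma abs_cutoff_sub_le {R : ℝ} (hR : 0 < R) (x y : ℝ) :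
    |cutoff R y - cutoff R x| ≤ R⁻¹ * |y - x| := by
  calc |cutoff R y - cutoff R x|
      ≤ |min 1 (2 - |y| / R) - min 1 (2 - |x| / R)| := by
        simpa [cutoff] using abs_max_sub_max_le_max 0 (min 1 (2 - |y| / R)) 0 (min 1 (2 - |x| / R))
    _ ≤ |(2 - |y| / R) - (2 - |x| / R)| := by
        simpa using abs_min_sub_min_le_max 1 (2 - |y| / R) 1 (2 - |x| / R)
    _ = R⁻¹ * |(|x| - |y|)| := by
        rw [show (2 - |y| / R) - (2 - |x| / R) = R⁻¹ * (|x| - |y|) by ring, abs_mul,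
          abs_of_pos (inv_pos.2 hR)]
    _ ≤ R⁻¹ * |y - x| := by
        rw [abs_sub_comm y x]
        exact mul_le_mul_of_nonneg_left (abs_abs_sub_abs_le x y) (inv_nonneg.2 hR.le)

lemma enorm_cutoff_sub_le {R : ℝ} (hR : 0 < R) {x y : ℝ} (hxy : x ≤ y) :
    ‖cutoff R y - cutoff R x‖ₑ ≤
      ∫⁻ t in Set.Ioc x y, (Set.Icc (-(2 * R)) (2 * R)).indicator
        (fun _ => ENNReal.ofReal R⁻¹) t := by
  -- Clamping to `[-2R, 2R]` leaves the cutoff unchanged, so the Lipschitz bound is paid only on the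
  -- part of `(x, y]` in that interval.
  set φ : ℝ → ℝ := fun x => max (-(2 * R)) (min (2 * R) x) with hφ
  have hφR : ∀ x, cutoff R (φ x) = cutoff R x := by
    intro x
    rcases le_total x (-(2 * R)) with h | h
    · have : φ x = -(2 * R) := by rw [hφ]; simp only; rw [min_eq_right (by linarith), max_eq_left h]
      rw [this, cutoff_eq_zero hR (by rw [abs_neg]; exact le_abs_self _),
        cutoff_eq_zero hR ((le_neg.2 h).trans (neg_le_abs _))]
    rcases le_total x (2 * R) with h' | h'
    · have : φ x = x := by rw [hφ]; simp only; rw [min_eq_right h', max_eq_right h]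
      rw [this]
    · have : φ x = 2 * R := by
        rw [hφ]; simp only; rw [min_eq_left h', max_eq_right (by linarith)]
      rw [this, cutoff_eq_zero hR (le_abs_self _), cutoff_eq_zero hR (h'.trans (le_abs_self _))]
  have hmono : φ x ≤ φ y := max_le_max_left _ (min_le_min_left _ hxy)
  have hsub : Set.Ioc (φ x) (φ y) ⊆ Set.Icc (-(2 * R)) (2 * R) ∩ Set.Ioc x y := by
    rintro t ⟨h1, h2⟩
    simp only [hφ, max_lt_iff, le_max_iff, le_min_iff, min_lt_iff] at h1 h2
    obtain ⟨h3, h4⟩ := h1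
    rcases h2 with h2 | ⟨h2, h5⟩
    · linarith
    · refine ⟨⟨h3.le, h2⟩, ?_, h5⟩
      rcases h4 with h4 | h4
      · linarith
      · exact h4
  calc ‖cutoff R y - cutoff R x‖ₑ
      = ENNReal.ofReal |cutoff R (φ y) - cutoff R (φ x)| := by
        rw [hφR, hφR, Real.enorm_eq_ofReal_abs]
    _ ≤ ENNReal.ofReal (R⁻¹ * (φ y - φ x)) := by
        refine ENNReal.ofReal_le_ofReal ((abs_cutoff_sub_le hR _ _).trans_eq ?_)
        rw [abs_of_nonneg (sub_nonneg.2 hmono)]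
    _ = ENNReal.ofReal R⁻¹ * volume (Set.Ioc (φ x) (φ y)) := by
        rw [Real.volume_Ioc, ENNReal.ofReal_mul (inv_nonneg.2 hR.le)]
    _ ≤ ENNReal.ofReal R⁻¹ * volume (Set.Icc (-(2 * R)) (2 * R) ∩ Set.Ioc x y) := by gcongr
    _ = _ := by
        rw [lintegral_indicator_const measurableSet_Icc, Measure.restrict_apply measurableSet_Icc]

/-- Slope `1/R` on length `4R` has squared L² norm `4/R`, which tends to 0 as `R` grows. -/
lemma lintegral_indicator_Icc_sq {R : ℝ} (hR : 0 < R) :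
    (∫⁻ t, (Set.Icc (-(2 * R)) (2 * R)).indicator (fun _ => ENNReal.ofReal R⁻¹) t ^ 2)
      ^ (1 / 2 : ℝ) = ENNReal.ofReal (4 / R) ^ (1 / 2 : ℝ) := by
  have : ∀ t, (Set.Icc (-(2 * R)) (2 * R)).indicator (fun _ => ENNReal.ofReal R⁻¹) t ^ 2 =
      (Set.Icc (-(2 * R)) (2 * R)).indicator (fun _ => ENNReal.ofReal R⁻¹ ^ 2) t := by
    intro t
    by_cases ht : t ∈ Set.Icc (-(2 * R)) (2 * R) <;> simp [ht, -Set.mem_Icc]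
  simp_rw [this]
  rw [lintegral_indicator_const measurableSet_Icc, Real.volume_Icc,
    ← ENNReal.ofReal_pow (by positivity), ← ENNReal.ofReal_mul (by positivity)]
  congr 2
  field_simp
  norm_num

lemma enorm_cutoff_mul_sub_le {f : ℝ → ℝ} {C : ℝ} {x : ℝ} (hx : |f x| ≤ C) (R y : ℝ) :
    ‖cutoff R y * f y - cutoff R x * f x‖ₑ ≤
      ‖f y - f x‖ₑ + ENNReal.ofReal C * ‖cutoff R y - cutoff R x‖ₑ := by
  have hC : 0 ≤ C := (abs_nonneg _).trans hx
  simp only [Real.enorm_eq_ofReal_abs]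
  rw [← ENNReal.ofReal_mul hC, ← ENNReal.ofReal_add (abs_nonneg _) (by positivity)]
  refine ENNReal.ofReal_le_ofReal ?_
  calc |cutoff R y * f y - cutoff R x * f x|
      = |cutoff R y * (f y - f x) + f x * (cutoff R y - cutoff R x)| := by ring_nf
    _ ≤ |cutoff R y * (f y - f x)| + |f x * (cutoff R y - cutoff R x)| := abs_add_le _ _
    _ ≤ _ := by
      rw [abs_mul, abs_mul, abs_of_nonneg (cutoff_nonneg _ _)]
      gcongr
      exact mul_le_of_le_one_left (abs_nonneg _) (cutoff_le_one _ _)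

/-! ### The pairing as an integral along a plan -/

lemma integrable_of_abs_le_of_eq_zero_off {X : Type*} [MeasurableSpace X] {μ : Measure X}
    {G : X → ℝ} {C : ℝ} {B : Set X} (hG : Measurable G) (hC : ∀ x, |G x| ≤ C) (hB : μ B ≠ ∞)
    (hGB : ∀ x, x ∉ B → G x = 0) : Integrable G μ := by
  rw [← integrableOn_iff_integrable_of_support_subset (s := B)
    fun x hx => by_contra fun h => hx (hGB x h)]
  exact Measure.integrableOn_of_bounded hB hG.aestronglyMeasurable
    (ae_of_all _ hC)

/-- Vanishing off a set of finite mass makes all four integrals in `ν + σ⁻ = μ + σ⁺` finite, so they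
can be rearranged. -/
lemma pairing_eq_integral_coupling {X : Type*} [MeasurableSpace X] {μ ν : Measure X}
    {σ : SignedMeasure X} (hσ : IsDifference σ ν μ) {π : Measure (X × X)}
    (hπ : IsCoupling μ ν π) {G : X → ℝ} {C : ℝ} {B : Set X} (hG : Measurable G)
    (hC : ∀ x, |G x| ≤ C) (hμB : μ B ≠ ∞) (hνB : ν B ≠ ∞) (hGB : ∀ x, x ∉ B → G x = 0) :
    pairing G σ = ∫ p, (G p.2 - G p.1) ∂π := by
  have hμ : Integrable G μ := integrable_of_abs_le_of_eq_zero_off hG hC hμB hGB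
  have hν : Integrable G ν := integrable_of_abs_le_of_eq_zero_off hG hC hνB hGB
  have hp : Integrable G σ.toJordanDecomposition.posPart :=
    integrable_of_abs_le_of_eq_zero_off hG hC (measure_ne_top _ B) hGB
  have hn : Integrable G σ.toJordanDecomposition.negPart :=
    integrable_of_abs_le_of_eq_zero_off hG hC (measure_ne_top _ B) hGB
  have h1 : ∫ x, G x ∂ν + ∫ x, G x ∂σ.toJordanDecomposition.negPart =
      ∫ x, G x ∂μ + ∫ x, G x ∂σ.toJordanDecomposition.posPart := by
    rw [← integral_add_measure hν hn, ← integral_add_measure hμ hp, hσ]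
  obtain ⟨h2, h3⟩ := hπ
  rw [← h2] at hμ h1
  rw [← h3] at hν h1
  rw [integral_map (by fun_prop) hν.aestronglyMeasurable,
    integral_map (by fun_prop) hμ.aestronglyMeasurable] at h1
  rw [show ∫ p, (G p.2 - G p.1) ∂π = ∫ p, G p.2 ∂π - ∫ p, G p.1 ∂π from
    integral_sub (hν.comp_measurable measurable_snd) (hμ.comp_measurable measurable_fst),
    pairing]
  linarith

lemma tendsto_pairing {X : Type*} [MeasurableSpace X] (σ : SignedMeasure X) {G : ℕ → X → ℝ}
    {g : X → ℝ} {C : ℝ} (hG : ∀ n, Measurable (G n)) (hC : ∀ n x, |G n x| ≤ C)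
    (hlim : ∀ x, Tendsto (fun n => G n x) atTop (𝓝 (g x))) :
    Tendsto (fun n => pairing (G n) σ) atTop (𝓝 (pairing g σ)) := by
  refine Tendsto.sub ?_ ?_ <;>
  exact tendsto_integral_of_dominated_convergence (fun _ => C)
    (fun n => (hG n).aestronglyMeasurable) (integrable_const _)
    (fun n => ae_of_all _ (hC n)) (ae_of_all _ hlim)

/-- A bounded set has finite mass under the second marginal of a plan of finite cost, as soon as
bounded sets have finite mass under the first marginal. -/
lemma measure_closedBall_ne_top_of_coupling {M : Set ℝ} {μ ν : Measure M} {π : Measure (M × M)}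
    (hπ : IsCoupling μ ν π) (hcost : transportCost π ≠ ∞)
    (hμ : ∀ r : ℝ, μ {x | |(x : ℝ)| ≤ r} ≠ ∞) (r : ℝ) : ν {x | |(x : ℝ)| ≤ r} ≠ ∞ := by
  have hmeas : ∀ s : ℝ, MeasurableSet {x : M | |(x : ℝ)| ≤ s} := fun s =>
    measurableSet_le (by fun_prop) measurable_const
  -- Mass landing in the ball of radius `r` either started within `r + 1` or travelled at least 1;
  -- Markov's inequality bounds the latter by the cost.
  have hfar : π {p | 1 ≤ edist p.1 p.2 ^ 2} ≠ ∞ := by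
    have := meas_ge_le_lintegral_div (μ := π) (f := fun p => edist p.1 p.2 ^ 2)
      (by fun_prop) one_ne_zero ENNReal.one_ne_top
    rw [div_one] at this
    exact ne_top_of_le_ne_top hcost this
  have hnear : π {p | |(p.1 : ℝ)| ≤ r + 1} ≠ ∞ := by
    have := hμ (r + 1)
    rwa [← hπ.1, Measure.map_apply measurable_fst (hmeas _)] at this
  rw [← hπ.2, Measure.map_apply measurable_snd (hmeas _)]
  refine ne_top_of_le_ne_top (ENNReal.add_ne_top.2 ⟨hnear, hfar⟩)
    ((measure_mono fun p hp => ?_).trans (measure_union_le _ _))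
  have hp : |(p.2 : ℝ)| ≤ r := hp
  by_cases h : |(p.1 : ℝ) - p.2| ≤ 1
  · left
    have := abs_sub_abs_le_abs_sub (p.1 : ℝ) p.2
    change |(p.1 : ℝ)| ≤ r + 1
    linarith
  · right
    refine one_le_pow₀ (M₀ := ℝ≥0∞) ?_
    rw [edist_dist, ENNReal.one_le_ofReal, Subtype.dist_eq, Real.dist_eq]
    exact (not_le.1 h).le

/-! ### Removing the cutoff and conclusion -/

lemma tendsto_ofReal_div_rpow :
    Tendsto (fun n : ℕ => ENNReal.ofReal (4 / (n + 1 : ℝ)) ^ (1 / 2 : ℝ)) atTop (𝓝 0) := by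
  have h1 : Tendsto (fun n : ℕ => 4 / (n + 1 : ℝ)) atTop (𝓝 0) := by
    simpa [div_eq_mul_inv] using (tendsto_one_div_add_atTop_nhds_zero_nat (𝕜 := ℝ)).const_mul 4
  have h2 := (ENNReal.tendsto_ofReal h1).ennrpow_const (1 / 2)
  simpa using h2

lemma enorm_pairing_le_of_coupling {M : Set ℝ} (hM : M.OrdConnected) {ρ₀ : ℝ≥0}
    {μ ν : Measure M} (hμ : μ ≤ ρ₀ • lebesgueOn M) {σ : SignedMeasure M}
    (hσ : IsDifference σ ν μ) {π : Measure (M × M)} (hπ : IsCoupling μ ν π)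
    (hcost : transportCost π ≠ ∞) {f : ℝ → ℝ} (hf : IsBoundedC1 M f) (hfn : H1seminorm M f ≤ 1) :
    ENNReal.ofReal |pairing (fun x : M => f x) σ| ≤
      2 * (ρ₀ * transportCost π) ^ (1 / 2 : ℝ) := by
  obtain ⟨hf1, C, hC⟩ := hf
  set K := (ρ₀ * transportCost π) ^ (1 / 2 : ℝ) with hK
  have hKtop : K ≠ ∞ := ENNReal.rpow_ne_top_of_nonneg (by norm_num)
    (ENNReal.mul_ne_top ENNReal.coe_ne_top hcost)
  have hval : Measurable fun p : M × M => ((p.1 : ℝ), (p.2 : ℝ)) := by fun_prop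
  set π' : Measure (ℝ × ℝ) := π.map fun p : M × M => ((p.1 : ℝ), (p.2 : ℝ)) with hπ'
  have hleb : (lebesgueOn M).map (Subtype.val : M → ℝ) ≤ volume := by
    rw [lebesgueOn, map_comap_subtype_coe hM.measurableSet]
    exact Measure.restrict_le_self
  have hμval : μ.map (Subtype.val : M → ℝ) ≤ (ρ₀ : ℝ≥0∞) • volume := by
    refine (Measure.map_mono hμ measurable_subtype_coe).trans ?_
    rw [Measure.map_smul]
    intro s
    simp only [Measure.smul_apply, ENNReal.smul_def, smul_eq_mul]
    gcongr
  have hfst : π'.map Prod.fst = μ.map (Subtype.val : M → ℝ) := by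
    rw [hπ', Measure.map_map measurable_fst hval, ← hπ.1,
      Measure.map_map measurable_subtype_coe measurable_fst]
    rfl
  have hfst' : π'.map Prod.fst ≤ (ρ₀ : ℝ≥0∞) • volume := hfst ▸ hμval
  -- Tonelli needs `π'` to be s-finite; this is inherited from its first marginal, dominated by a
  -- multiple of Lebesgue measure.
  have : SigmaFinite (π'.map Prod.fst) := by
    have : SigmaFinite ((ρ₀ : ℝ≥0∞) • (volume : Measure ℝ)) :=
      inferInstanceAs (SigmaFinite (ρ₀ • (volume : Measure ℝ)))
    exact Measure.sigmaFinite_of_le _ hfst'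
  have : SigmaFinite π' := SigmaFinite.of_map _ measurable_fst.aemeasurable this
  have hcost' : transportCost π' = transportCost π := by
    rw [transportCost, hπ', lintegral_map (by fun_prop) hval]
    rfl
  have hmem : ∀ᵐ p ∂π', p.1 ∈ M ∧ p.2 ∈ M := by
    refine (ae_map_iff hval.aemeasurable ((measurable_fst hM.measurableSet).inter
      (measurable_snd hM.measurableSet))).2 ?_
    exact ae_of_all _ fun p => ⟨p.1.2, p.2.2⟩
  have hbound : ∀ (F : ℝ → ℝ) (h : ℝ → ℝ≥0∞), Measurable h →
      (∀ x ∈ M, ∀ y ∈ M, x ≤ y → ‖F y - F x‖ₑ ≤ ∫⁻ t in Set.Ioc x y, h t) →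
      ∫⁻ p, ‖F p.2 - F p.1‖ₑ ∂π' ≤ 2 * (K * (∫⁻ t, h t ^ 2) ^ (1 / 2 : ℝ)) := by
    intro F h hh hF
    have := lintegral_enorm_sub_le π' ρ₀ hfst' hmem F h hh hF
    rwa [hcost'] at this
  have hμball : ∀ r : ℝ, μ {x | |(x : ℝ)| ≤ r} ≠ ∞ := by
    intro r
    have h1 := hμval (Set.Icc (-r) r)
    rw [Measure.map_apply measurable_subtype_coe measurableSet_Icc, Measure.smul_apply,
      Real.volume_Icc, smul_eq_mul] at h1
    refine ne_top_of_le_ne_top (ENNReal.mul_ne_top ENNReal.coe_ne_top ENNReal.ofReal_ne_top)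
      ((measure_mono fun x hx => ?_).trans h1)
    exact abs_le.1 hx
  have hνball := measure_closedBall_ne_top_of_coupling hπ hcost hμball
  have hfm : Measurable fun x : M => f x := hf1.continuousOn.domRestrict.measurable
  set G : ℕ → M → ℝ := fun n x => cutoff (n + 1) x * f x with hG
  have hpos : ∀ n : ℕ, (0 : ℝ) < n + 1 := fun n => by positivity
  have hGm : ∀ n, Measurable (G n) := fun n =>
    ((continuous_cutoff _).measurable.comp measurable_subtype_coe).mul hfm
  have hGC : ∀ n x, |G n x| ≤ C := fun n x => by
    rw [hG, abs_mul, abs_of_nonneg (cutoff_nonneg _ _)]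
    exact (mul_le_of_le_one_left (abs_nonneg _) (cutoff_le_one _ _)).trans (hC x x.2)
  have hlim : Tendsto (fun n => pairing (G n) σ) atTop (𝓝 (pairing (fun x : M => f x) σ)) := by
    refine tendsto_pairing σ hGm hGC fun x => ?_
    refine tendsto_const_nhds.congr' ?_
    filter_upwards [(tendsto_natCast_atTop_atTop (R := ℝ)).eventually_ge_atTop |(x : ℝ)|]
      with n hn
    simp only [hG]
    rw [cutoff_eq_one (hpos n) (by linarith), one_mul]
  have hGle : ∀ n : ℕ, ENNReal.ofReal |pairing (G n) σ| ≤
      2 * K + ENNReal.ofReal C * (2 * (K * ENNReal.ofReal (4 / (n + 1 : ℝ)) ^ (1 / 2 : ℝ))) := by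
    intro n
    have hGB : ∀ x : M, x ∉ {x : M | |(x : ℝ)| ≤ 2 * (n + 1)} → G n x = 0 := fun x hx => by
      simp only [hG]
      rw [cutoff_eq_zero (hpos n) (not_le.1 hx).le, zero_mul]
    rw [pairing_eq_integral_coupling hσ hπ (hGm n) (hGC n) (hμball _) (hνball _) hGB,
      ← Real.enorm_eq_ofReal_abs]
    calc ‖∫ p, (G n p.2 - G n p.1) ∂π‖ₑ
        ≤ ∫⁻ p, ‖G n p.2 - G n p.1‖ₑ ∂π := enorm_integral_le_lintegral_enorm _
      _ ≤ ∫⁻ p, (‖f p.2 - f p.1‖ₑ + ENNReal.ofReal C *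
            ‖cutoff (n + 1) p.2 - cutoff (n + 1) p.1‖ₑ) ∂π :=
          lintegral_mono fun p => enorm_cutoff_mul_sub_le (hC _ p.1.2) _ _
      _ = (∫⁻ p, ‖f p.2 - f p.1‖ₑ ∂π) + ENNReal.ofReal C *
            ∫⁻ p, ‖cutoff (n + 1) p.2 - cutoff (n + 1) p.1‖ₑ ∂π := by
          have hc : Measurable (cutoff (n + 1)) := (continuous_cutoff _).measurable
          have hfd : Measurable fun p : M × M => ‖f p.2 - f p.1‖ₑ :=
            ((hfm.comp measurable_snd).sub (hfm.comp measurable_fst)).enorm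
          rw [lintegral_add_left hfd, lintegral_const_mul _ (by fun_prop)]
      _ ≤ _ := by
          gcongr
          -- `f` is arbitrary off `M`; extending it by zero makes it measurable on ℝ without
          -- changing its increments between points of `M`.
          · have h1 := hbound (M.indicator f) _ 
              (measurable_indicator_of_continuousOn hM.measurableSet
                (continuousOn_derivWithin_of_ordConnected hM hf1).enorm)
              fun x hx y hy hxy => by
                rw [Set.indicator_of_mem hx, Set.indicator_of_mem hy]
                exact enorm_sub_le_setLIntegral_derivWithin hM hf1 hx hy hxy
            have hfi : Measurable (M.indicator f) :=
              measurable_indicator_of_continuousOn hM.measurableSet hf1.continuousOn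
            rw [lintegral_indicator_derivWithin_sq hM, hπ', lintegral_map (by fun_prop) hval]
              at h1
            simp only [Set.indicator_of_mem (Subtype.coe_prop _)] at h1
            refine h1.trans ?_
            gcongr
            exact mul_le_of_le_one_right' hfn
          · have hc : Measurable (cutoff (n + 1)) := (continuous_cutoff _).measurable
            have h1 := hbound (cutoff (n + 1)) _
              (measurable_const.indicator measurableSet_Icc)
              fun x _ y _ hxy => enorm_cutoff_sub_le (hpos n) hxy
            rwa [lintegral_indicator_Icc_sq (hpos n), hπ', lintegral_map (by fun_prop) hval]
              at h1
  have hlim' : Tendsto (fun n : ℕ => 2 * K + ENNReal.ofReal C *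
      (2 * (K * ENNReal.ofReal (4 / (n + 1 : ℝ)) ^ (1 / 2 : ℝ)))) atTop (𝓝 (2 * K)) := by
    have h1 := ENNReal.Tendsto.const_mul (a := K) tendsto_ofReal_div_rpow (Or.inr hKtop)
    have h2 := ENNReal.Tendsto.const_mul (a := 2) h1 (Or.inr (by simp))
    have h3 := ENNReal.Tendsto.const_mul (a := ENNReal.ofReal C) h2 (Or.inr (by simp))
    simpa using h3.const_add (2 * K)
  exact le_of_tendsto_of_tendsto' (ENNReal.tendsto_ofReal hlim.abs) hlim' hGle

end HSobolevWasserstein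

theorem theorem3 (M : Set ℝ) (hM : M.OrdConnected) (ρ₀ : ℝ≥0) (hρ₀ : 0 < ρ₀)
    (μ : Measure M) (hμ : μ ≤ ρ₀ • HSobolevWasserstein.lebesgueOn M) (ν : Measure M)
    (σ : SignedMeasure M) (hσ : HSobolevWasserstein.IsDifference σ ν μ) :
    HSobolevWasserstein.Hm1norm M σ ≤
      2 * (ρ₀ : ℝ≥0∞) ^ (1 / 2 : ℝ) * HSobolevWasserstein.W2 μ ν := by
  refine iSup_le fun f => iSup₂_le fun hf hfn => ?_
  have hhalf : (0 : ℝ) ≤ 1 / 2 := by norm_num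
  set X := ENNReal.ofReal |HSobolevWasserstein.pairing (fun x : M => f x) σ|
  set c := 2 * (ρ₀ : ℝ≥0∞) ^ (1 / 2 : ℝ) with hc
  have hc0 : c ≠ 0 := mul_ne_zero two_ne_zero (by
    rw [Ne, ENNReal.rpow_eq_zero_iff]
    simp [hρ₀.ne'])
  have hctop : c ≠ ∞ :=
    ENNReal.mul_ne_top (by simp) (ENNReal.rpow_ne_top_of_nonneg hhalf ENNReal.coe_ne_top)
  -- As `c` is neither 0 nor ∞, the constant and the square root move to the left, leaving a bare
  -- infimum over plans to bound below.
  rw [mul_comm, ← ENNReal.div_le_iff hc0 hctop, HSobolevWasserstein.W2, one_div,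
    ENNReal.le_rpow_inv_iff two_pos]
  refine le_iInf₂ fun π hπ => ?_
  rw [← ENNReal.le_rpow_inv_iff two_pos, ENNReal.div_le_iff hc0 hctop, mul_comm]
  by_cases hcost : HSobolevWasserstein.transportCost π = ∞
  · rw [hcost, ENNReal.top_rpow_of_pos (by norm_num), ENNReal.mul_top hc0]
    exact le_top
  · have := HSobolevWasserstein.enorm_pairing_le_of_coupling hM hμ hσ hπ hcost hf hfn
    rwa [ENNReal.mul_rpow_of_nonneg _ _ hhalf, ← mul_assoc, ← hc, one_div 2] at this
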